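/- Let $p$ be a prime, $q$ a power of $p$, and $\mathbb{F}_{q^2}$ the finite field of order $q^2$. Let $n=\overline{n}p^{\nu}$ be a positive integer with $p\nmid\overline{n}$ and $\nu\ge 0$. Let $\lambda\in\mathbb{F}_{q^2}$ be a nonzero element of multiplicative order $r$ with $r\mid(q+1)$, and let $\Lambda\in\mathbb{F}_{q^2}$ be the element with $\Lambda^{p^{\nu}}=\lambda$. For a polynomial $f(x)=a_0+a_1x+\dots+a_kx^k\in\mathbb{F}_{q^2}[x]$ of degree $k$ with $a_0\neq 0$, put $f^{\dagger}(x)=a_0^{-q}\sum_{i=0}^{k}a_i^{q}x^{k-i}$; $f$ is called self-conjugate-reciprocal if $f=f^{\dagger}$. Let $B=B^{H}_{\overline{n},\lambda,q^2}$ be the sum of the degrees of the self-conjugate-reciprocal polynomials in the factorization of $x^{\overline{n}}-\Lambda$ into monic irreducible polynomials over $\mathbb{F}_{q^2}$. Let $M_q$ be the set of positive integers $\ell$ that divide $q^i+1$ for some odd positive integer $i$. For a positive integer $m$ let $\beta(m)$ be the exponent of $2$ in $m$, and let $\gamma\ge 0$ be the integer such that $2^{\gamma}$ divides $q+1$ and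 $2^{\gamma+1}$ does not. Then the following statements hold. 1. If $r$ is even, then $B\neq 0$ if and only if $\beta(\overline{n})+\beta(r)\le\gamma$ and $r\in M_q$. 2. If $r$ is odd, then $B\neq 0$ if and only if $r\in M_q$. Equivalently: if $r$ is even, then $B=0$ if and only if $\beta(\overline{n})+\beta(r)>\gamma$ or $r\notin M_q$; if $r$ is odd, then $B=0$ if and only if $r\notin M_q$. -/

import Mathlib

open Polynomial

/-- The conjugate-reciprocal polynomial
`f†(x) = a₀^{-q} ∑_{i=0}^{k} a_i^q x^{k-i}` of a polynomial `f = a₀ + a₁ x + ⋯ + a_k x^k`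
of degree `k` (meaningful when `a₀ ≠ 0`). -/
noncomputable def conjRecip {F : Type*} [Field F] (q : ℕ) (f : F[X]) : F[X] :=
  C ((f.coeff 0 ^ q)⁻¹) *
    ∑ i ∈ Finset.range (f.natDegree + 1), C (f.coeff i ^ q) * X ^ (f.natDegree - i)

/-- A polynomial with nonzero constant term is self-conjugate-reciprocal if `f = f†`. -/
def IsSelfConjRecip {F : Type*} [Field F] (q : ℕ) (f : F[X]) : Prop :=
  f.coeff 0 ≠ 0 ∧ f = conjRecip q f

open Classical in
/-- The sum of the degrees of the self-conjugate-reciprocal polynomials occurring in the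
factorization of `x^m - Λ` into monic irreducible polynomials (with multiplicity). -/
noncomputable def selfConjRecipDegree {F : Type*} [Field F] (q m : ℕ) (Lam : F) : ℕ :=
  (((UniqueFactorizationMonoid.normalizedFactors (X ^ m - C Lam : F[X])).filter
    (fun g => IsSelfConjRecip q g)).map natDegree).sum

/-- The set `M_q` of the positive integers dividing `q^i + 1` for some odd positive `i`. -/
def setM (q : ℕ) : Set ℕ :=
  {l | 1 ≤ l ∧ ∃ i : ℕ, 0 < i ∧ Odd i ∧ l ∣ q ^ i + 1}

/-! If `x` is a root of an irreducible `g`, then `x^(-q)` is a root of `g†`. So `g = g†` exactly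
when `x^(-q)` is a conjugate `x^(q^(2j))` of `x`, that is, when `x^(q^i+1) = 1` for some odd `i`.
Hence `B ≠ 0` iff `Λ` has an `n̄`-th root of such an order. As `Λ` has order `r ∣ q + 1`, the
condition `r ∈ M_q` is automatic and the only obstruction is 2-adic: for odd `q` and `i`, `q^i+1`
and `q+1` have the same 2-part, whereas at odd primes dividing `r` lifting the exponent makes
`q^i+1` as divisible as needed. -/

/-! ### Conjugate-reciprocal polynomials and their roots -/

/-- Over a field of characteristic `p`, the conjugate-reciprocal polynomial vanishes at the
`-q`-th powers of the roots of the polynomial. -/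
theorem aeval_conjRecip {F K : Type*} [Field F] [Field K] [Algebra F K] (p : ℕ) [Fact p.Prime]
    [CharP F p] (e : ℕ) (f : F[X]) {y : K} (hy : y ≠ 0) :
    aeval ((y ^ p ^ e)⁻¹) (conjRecip (p ^ e) f) =
      algebraMap F K ((f.coeff 0 ^ p ^ e)⁻¹) *
        (((y ^ p ^ e)⁻¹) ^ f.natDegree * (aeval y f) ^ p ^ e) := by
  have : CharP K p := charP_of_injective_algebraMap (algebraMap F K).injective p
  rw [conjRecip, map_mul, aeval_C, map_sum]
  congr 1
  rw [aeval_eq_sum_range, sum_pow_char_pow, Finset.mul_sum]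
  refine Finset.sum_congr rfl fun i hi => ?_
  have hi : i ≤ f.natDegree := Nat.lt_succ_iff.mp (Finset.mem_range.mp hi)
  have hz : y ^ p ^ e ≠ 0 := pow_ne_zero _ hy
  rw [map_mul, aeval_C, map_pow, map_pow, aeval_X, Algebra.smul_def, mul_pow, pow_right_comm y,
    pow_sub₀ _ (inv_ne_zero hz) hi, inv_pow _ i, inv_inv]
  ring

theorem natDegree_conjRecip_le {F : Type*} [Field F] (q : ℕ) (f : F[X]) :
    (conjRecip q f).natDegree ≤ f.natDegree := by
  refine (natDegree_C_mul_le _ _).trans (natDegree_sum_le_of_forall_le _ _ fun i _ => ?_)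
  exact (natDegree_C_mul_X_pow_le _ _).trans (Nat.sub_le _ _)

theorem monic_conjRecip {F : Type*} [Field F] (q : ℕ) {f : F[X]} (hf : f.coeff 0 ≠ 0) :
    (conjRecip q f).Monic := by
  refine monic_of_natDegree_le_of_coeff_eq_one f.natDegree (natDegree_conjRecip_le q f) ?_
  rw [conjRecip, coeff_C_mul, finsetSum_coeff, Finset.sum_eq_single 0]
  · simp only [Nat.sub_zero, coeff_C_mul_X_pow, if_true]
    exact inv_mul_cancel₀ (pow_ne_zero _ hf)
  · intro i hi hi0
    have : f.natDegree ≠ f.natDegree - i := by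
      have := Finset.mem_range.mp hi
      omega
    rw [coeff_C_mul_X_pow, if_neg this]
  · simp

/-- Conjugate elements of an extension of finite fields differ by a power of the Frobenius. -/
theorem exists_eq_pow_card_pow_of_aeval_eq_zero {F L : Type*} [Field F] [Finite F] [Field L]
    [Finite L] [Algebra F L] {g : F[X]} (hg : Irreducible g) {x y : L} (hx : aeval x g = 0)
    (hy : aeval y g = 0) : ∃ j : ℕ, y = x ^ Nat.card F ^ j := by
  have := Fintype.ofFinite F
  have hxy : IsConjRoot F y x := by
    rw [isConjRoot_def, ← minpoly.eq_of_irreducible hg hx, ← minpoly.eq_of_irreducible hg hy]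
  obtain ⟨σ, hσ⟩ := hxy.exists_algEquiv
  obtain ⟨j, hj⟩ := (FiniteField.bijective_frobeniusAlgEquivOfAlgebraic_pow F L).2 σ
  refine ⟨j, ?_⟩
  rw [← hσ, ← hj]
  simp only [AlgEquiv.coe_pow, FiniteField.coe_frobeniusAlgEquivOfAlgebraic_iterate,
    Nat.card_eq_fintype_card]

/-- A root of an irreducible self-conjugate-reciprocal polynomial over the field of order `q ^ 2`
has order dividing `q ^ i + 1` for some odd `i`. -/
theorem IsSelfConjRecip.exists_pow_eq_one {F L : Type*} [Field F] [Finite F] [Field L] [Finite L]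
    [Algebra F L] (p : ℕ) [Fact p.Prime] [CharP F p] (e : ℕ) (hF : Nat.card F = (p ^ e) ^ 2)
    {g : F[X]} (hirr : Irreducible g) (hg : IsSelfConjRecip (p ^ e) g) {x : L} (hx0 : x ≠ 0)
    (hx : aeval x g = 0) : ∃ i : ℕ, Odd i ∧ x ^ ((p ^ e) ^ i + 1) = 1 := by
  have : CharP L p := charP_of_injective_algebraMap (algebraMap F L).injective p
  have hp := (Fact.out : p.Prime)
  have hx' : aeval ((x ^ p ^ e)⁻¹) g = 0 := by
    rw [hg.2, aeval_conjRecip p e g hx0, hx, zero_pow (pow_ne_zero _ hp.ne_zero)]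
    simp
  obtain ⟨j, hj⟩ := exists_eq_pow_card_pow_of_aeval_eq_zero hirr hx hx'
  have hprod : x ^ (Nat.card F ^ j) * x ^ p ^ e = 1 := by
    rw [← hj, inv_mul_cancel₀ (pow_ne_zero _ hx0)]
  rcases j with _ | j
  · exact ⟨1, odd_one, by simpa [pow_succ, mul_comm] using hprod⟩
  -- Here `hprod` is the `q`-th power of the wanted equation; injectivity of Frobenius removes it.
  · refine ⟨2 * j + 1, odd_two_mul_add_one j, iterateFrobenius_inj L p e ?_⟩
    rw [iterateFrobenius_def, map_one, ← pow_mul, ← hprod, ← pow_add, hF]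
    congr 1
    ring

theorem aeval_pow_card_pow {F K : Type*} [Field F] [Finite F] [Field K] [Algebra F K] (f : F[X])
    (x : K) (j : ℕ) : aeval (x ^ Nat.card F ^ j) f = (aeval x f) ^ Nat.card F ^ j := by
  have := Fintype.ofFinite F
  induction j with
  | zero => simp
  | succ j ih =>
    rw [pow_succ, pow_mul, pow_mul, ← ih, ← map_pow, ← expand_aeval, Nat.card_eq_fintype_card,
      FiniteField.expand_card]

/-- The minimal polynomial, over the field of order `q ^ 2`, of an element whose order divides
`q ^ i + 1` for an odd `i` is self-conjugate-reciprocal. -/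
theorem isSelfConjRecip_minpoly {F K : Type*} [Field F] [Finite F] [Field K] [Algebra F K]
    (p : ℕ) [Fact p.Prime] [CharP F p] (e : ℕ) (hF : Nat.card F = (p ^ e) ^ 2) {x : K}
    (hx : IsIntegral F x) {i : ℕ} (hi : Odd i) (hxi : x ^ ((p ^ e) ^ i + 1) = 1) :
    IsSelfConjRecip (p ^ e) (minpoly F x) := by
  have hp := (Fact.out : p.Prime)
  have hx0 : x ≠ 0 := by
    rintro rfl
    simp at hxi
  have h0 : (minpoly F x).coeff 0 ≠ 0 := minpoly.coeff_zero_ne_zero hx hx0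
  refine ⟨h0, (eq_of_monic_of_dvd_of_natDegree_le (minpoly.monic hx) (monic_conjRecip _ h0) ?_
    (natDegree_conjRecip_le _ _)).symm⟩
  obtain ⟨j, rfl⟩ := hi
  set y : K := (x ^ p ^ e)⁻¹ with hy
  have hyx : y = x ^ Nat.card F ^ (j + 1) := by
    rw [hy, inv_eq_iff_eq_inv]
    refine eq_inv_of_mul_eq_one_right ?_
    rw [hF, ← pow_add]
    calc _ = (x ^ ((p ^ e) ^ (2 * j + 1) + 1)) ^ p ^ e := by
          rw [← pow_mul x]
          congr 1
          ring
      _ = 1 := by rw [hxi, one_pow]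
  have hroot : aeval y (minpoly F x) = 0 := by
    rw [hyx, aeval_pow_card_pow, minpoly.aeval, zero_pow (pow_ne_zero _ Nat.card_pos.ne')]
  have hmin : minpoly F x = minpoly F y :=
    minpoly.eq_of_irreducible_of_monic (minpoly.irreducible hx) hroot (minpoly.monic hx)
  -- Both sides being monic, with the degree bound it is enough that `y` is a root of the
  -- conjugate-reciprocal.
  conv_lhs => rw [hmin]
  refine minpoly.dvd F y ?_
  rw [hy, aeval_conjRecip p e _ hx0, minpoly.aeval, zero_pow (pow_ne_zero _ hp.ne_zero)]
  simp

/-- Irreducible factors have positive degree, so the sum vanishes only if it is empty. -/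
theorem selfConjRecipDegree_ne_zero_iff {F : Type*} [Field F] (q : ℕ) {m : ℕ} (hm : 0 < m)
    (a : F) :
    selfConjRecipDegree q m a ≠ 0 ↔
      ∃ g : F[X], Irreducible g ∧ g.Monic ∧ g ∣ X ^ m - C a ∧ IsSelfConjRecip q g := by
  classical
  have h0 : (X ^ m - C a : F[X]) ≠ 0 := X_pow_sub_C_ne_zero hm a
  rw [selfConjRecipDegree, Ne, Multiset.sum_eq_zero_iff]
  push Not
  simp only [Multiset.mem_map, Multiset.mem_filter]
  constructor
  · rintro ⟨_, ⟨g, ⟨hg, hs⟩, rfl⟩, -⟩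
    have := (Polynomial.mem_normalizedFactors_iff h0).mp hg
    exact ⟨g, this.1, this.2.1, this.2.2, hs⟩
  · rintro ⟨g, hirr, hmon, hdvd, hs⟩
    exact ⟨_, ⟨g, ⟨(Polynomial.mem_normalizedFactors_iff h0).mpr ⟨hirr, hmon, hdvd⟩, hs⟩, rfl⟩,
      hirr.natDegree_pos.ne'⟩

/-- `x ^ m - a` has a self-conjugate-reciprocal irreducible factor over the field of order `q ^ 2`
if and only if it has a root whose order divides `q ^ i + 1` for some odd `i`. -/
theorem selfConjRecipDegree_ne_zero_iff_exists_root {F : Type*} [Field F] [Finite F] (p : ℕ)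
    [Fact p.Prime] [CharP F p] (e : ℕ) (hF : Nat.card F = (p ^ e) ^ 2) {m : ℕ} (hm : 0 < m)
    {a : F} (ha : a ≠ 0) :
    selfConjRecipDegree (p ^ e) m a ≠ 0 ↔
      ∃ x : AlgebraicClosure F, x ^ m = algebraMap F _ a ∧
        ∃ i : ℕ, Odd i ∧ x ^ ((p ^ e) ^ i + 1) = 1 := by
  rw [selfConjRecipDegree_ne_zero_iff _ hm]
  constructor
  · rintro ⟨g, hirr, -, hdvd, hs⟩
    have := Fact.mk hirr
    have : Module.Finite F (AdjoinRoot g) := (AdjoinRoot.powerBasis hirr.ne_zero).finite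
    have : Finite (AdjoinRoot g) := Module.finite_of_finite F
    have hroot : aeval (AdjoinRoot.root g) g = 0 := by
      rw [AdjoinRoot.aeval_eq, AdjoinRoot.mk_self]
    have hpow : AdjoinRoot.root g ^ m = algebraMap F _ a := by
      have h := aeval_eq_zero_of_dvd_aeval_eq_zero hdvd hroot
      rwa [map_sub, map_pow, aeval_X, aeval_C, sub_eq_zero] at h
    have hne : AdjoinRoot.root g ≠ 0 := by
      intro h
      rw [h, zero_pow hm.ne'] at hpow
      exact ha ((map_eq_zero _).mp hpow.symm)
    obtain ⟨i, hi, hxi⟩ := hs.exists_pow_eq_one p e hF hirr hne hroot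
    let φ : AdjoinRoot g →ₐ[F] AlgebraicClosure F := IsAlgClosed.lift
    refine ⟨φ (AdjoinRoot.root g), ?_, i, hi, ?_⟩
    · rw [← map_pow, hpow, φ.commutes]
    · rw [← map_pow, hxi, map_one]
  · rintro ⟨x, hxm, i, hi, hxi⟩
    have hx : IsIntegral F x := Algebra.IsIntegral.isIntegral x
    refine ⟨minpoly F x, minpoly.irreducible hx, minpoly.monic hx, minpoly.dvd F x ?_,
      isSelfConjRecip_minpoly p e hF hx hi hxi⟩
    simp [hxm]

/-! ### Roots of unity and divisibility of `q^i + 1` -/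

/-- An element of the group of `N`-th roots of unity has an `m`-th root in that group when its
order times `gcd N m` divides `N`. -/
theorem exists_pow_eq_and_pow_eq_one {K : Type*} [Field K] {N m : ℕ} [NeZero N]
    [HasEnoughRootsOfUnity K N] {a : K} (h : orderOf a * N.gcd m ∣ N) :
    ∃ x : K, x ^ m = a ∧ x ^ N = 1 := by
  obtain ⟨ζ, hζ⟩ := HasEnoughRootsOfUnity.exists_primitiveRoot K N
  have haN : a ^ N = 1 := orderOf_dvd_iff_pow_eq_one.mp ((dvd_mul_right _ _).trans h)
  obtain ⟨b, -, rfl⟩ := hζ.eq_pow_of_pow_eq_one haN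
  have hN : 0 < N := Nat.pos_of_ne_zero (NeZero.ne N)
  have hg : 0 < N.gcd m := Nat.gcd_pos_of_pos_left m hN
  obtain ⟨c, hc⟩ := Nat.gcd_dvd_left N m
  -- With `a = ζ^b`, the order of `a` divides `c = N / gcd N m`, so `gcd N m ∣ b`; Bézout then makes
  -- `ζ^(gcd N m)` an `m`-th power.
  have hbN : N ∣ b * c := by
    rw [← hζ.pow_eq_one_iff_dvd, pow_mul]
    refine orderOf_dvd_iff_pow_eq_one.mp (Nat.dvd_of_mul_dvd_mul_right hg ?_)
    rwa [mul_comm c, ← hc]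
  have hc0 : 0 < c := Nat.pos_of_ne_zero fun h0 => by simp [h0] at hc; omega
  have hgb : N.gcd m ∣ b := by
    refine Nat.dvd_of_mul_dvd_mul_right hc0 ?_
    rwa [← hc]
  obtain ⟨d, hd⟩ := hgb
  have key : ζ ^ N.gcd m = (ζ ^ (Nat.gcdB N m)) ^ m := by
    have hζ0 : ζ ≠ 0 := hζ.ne_zero hN.ne'
    rw [← zpow_natCast, Nat.gcd_eq_gcd_ab, zpow_add₀ hζ0, zpow_mul, zpow_natCast, hζ.pow_eq_one,
      one_zpow, one_mul, mul_comm, zpow_mul, zpow_natCast]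
  refine ⟨(ζ ^ (Nat.gcdB N m)) ^ d, ?_, ?_⟩
  · rw [pow_right_comm, ← key, ← pow_mul, ← hd]
  · rw [pow_right_comm, ← zpow_natCast (ζ ^ _), ← zpow_mul, mul_comm, zpow_mul, zpow_natCast,
      hζ.pow_eq_one, one_zpow, one_pow]

/-- For odd `i`, the numbers `q ^ i + 1` and `q + 1` are divisible by the same powers of two, as
long as `q` is odd. -/
theorem not_two_pow_dvd_pow_add_one {q γ i : ℕ} (hq : Odd q) (hγ : 2 ^ γ ∣ q + 1)
    (hγ' : ¬ 2 ^ (γ + 1) ∣ q + 1) (hi : Odd i) : ¬ 2 ^ (γ + 1) ∣ q ^ i + 1 := by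
  obtain ⟨j, rfl⟩ := hi
  have hsq : q ^ 2 ≡ 1 [MOD 2 ^ (γ + 1)] := by
    obtain ⟨t, rfl⟩ := hq
    refine ((Nat.modEq_iff_dvd' (Nat.one_le_pow _ _ (by omega))).mpr ?_).symm
    have : (2 * t + 1) ^ 2 - 1 = (2 * t + 1 + 1) * 2 * t := by
      rw [Nat.sub_eq_iff_eq_add (Nat.one_le_pow _ _ (by omega))]
      ring
    rw [this, pow_succ]
    exact (mul_dvd_mul_right hγ 2).trans (dvd_mul_right _ _)
  have h : q ^ (2 * j + 1) + 1 ≡ q + 1 [MOD 2 ^ (γ + 1)] := by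
    have := ((hsq.pow j).mul_right q).add_right 1
    rwa [one_pow, one_mul, ← pow_mul, ← pow_succ] at this
  rwa [h.dvd_iff (dvd_refl _)]

/-- If `r ∣ q + 1`, and `β r = 0` or `β m + β r ≤ β (q + 1)` where `β` is the exponent of two, then
`r * gcd (q ^ i + 1) m` divides `q ^ i + 1` for some odd `i`. -/
theorem exists_odd_mul_gcd_dvd {q m r γ : ℕ} (hm : m ≠ 0) (hr : r ∣ q + 1) (hγ : 2 ^ γ ∣ q + 1)
    (h : Odd r ∨ padicValNat 2 m + padicValNat 2 r ≤ γ) :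
    ∃ i : ℕ, Odd i ∧ r * (q ^ i + 1).gcd m ∣ q ^ i + 1 := by
  have hr0 : r ≠ 0 := by
    rintro rfl
    simp at hr
  -- The odd part of `m` supplies the missing `v_l(m)` at each odd prime `l ∣ r`.
  set i := ordCompl[2] m with hidef
  have hi : Odd i := (Nat.coprime_ordCompl Nat.prime_two hm).symm.odd_of_right
  refine ⟨i, hi, ?_⟩
  have hi0 : i ≠ 0 := hi.pos.ne'
  have hq : q + 1 ∣ q ^ i + 1 := by simpa using hi.nat_add_dvd_pow_add_pow q 1
  have hN : q ^ i + 1 ≠ 0 := Nat.succ_ne_zero _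
  have hg : (q ^ i + 1).gcd m ≠ 0 := Nat.gcd_ne_zero_right hm
  rw [← Nat.factorization_prime_le_iff_dvd (mul_ne_zero hr0 hg) hN]
  intro l hl
  have := Fact.mk hl
  have hgm : ((q ^ i + 1).gcd m).factorization l ≤ m.factorization l :=
    (Nat.factorization_le_iff_dvd hg hm).mpr (Nat.gcd_dvd_right _ _) l
  have hgN : ((q ^ i + 1).gcd m).factorization l ≤ (q ^ i + 1).factorization l :=
    (Nat.factorization_le_iff_dvd hg hN).mpr (Nat.gcd_dvd_left _ _) l
  have hrq : r.factorization l ≤ (q + 1).factorization l :=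
    (Nat.factorization_le_iff_dvd hr0 q.succ_ne_zero).mpr hr l
  rw [Nat.factorization_mul hr0 hg, Finsupp.add_apply]
  -- Away from `r` the gcd alone suffices; this covers `l = 2` when `r` is odd.
  by_cases hlr : l ∣ r
  swap
  · rw [Nat.factorization_eq_zero_of_not_dvd hlr]
    omega
  rcases hl.eq_two_or_odd' with rfl | hodd
  · rcases h with h | h
    · exact absurd (even_iff_two_dvd.mpr hlr) (Nat.not_even_iff_odd.mpr h)
    · have : γ ≤ (q ^ i + 1).factorization 2 :=
        (Nat.prime_two.pow_dvd_iff_le_factorization hN).mp (hγ.trans hq)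
      rw [← Nat.factorization_def _ Nat.prime_two, ← Nat.factorization_def _ Nat.prime_two] at h
      omega
  · have hl2 : l ≠ 2 := by
      rintro rfl
      exact absurd hodd (by decide)
    have hlq : l ∣ q + 1 := hlr.trans hr
    have hlq' : ¬ l ∣ q := fun hd => hl.one_lt.ne' (Nat.dvd_one.mp ((Nat.dvd_add_right hd).mp hlq))
    have hlte := padicValNat.pow_add_pow (p := l) hodd hlq hlq' hi
    rw [one_pow, ← Nat.factorization_def _ hl, ← Nat.factorization_def _ hl,
      ← Nat.factorization_def _ hl] at hlte
    have him : i.factorization l = m.factorization l := by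
      rw [hidef, Nat.factorization_ordCompl, Finsupp.erase_ne hl2]
    omega

/-- If `x` has order dividing a number not divisible by `2 ^ (γ + 1)` and `x ^ m` has even order
`r`, then `β m + β r ≤ γ` where `β` is the exponent of two. -/
theorem padicValNat_add_padicValNat_orderOf_pow_le {G : Type*} [Monoid G] {x : G} {N m γ : ℕ}
    (hN0 : N ≠ 0) (hm : m ≠ 0) (hx : x ^ N = 1) (hN : ¬ 2 ^ (γ + 1) ∣ N)
    (heven : Even (orderOf (x ^ m))) :
    padicValNat 2 m + padicValNat 2 (orderOf (x ^ m)) ≤ γ := by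
  have hdN : orderOf x ∣ N := orderOf_dvd_of_pow_eq_one hx
  have hd0 : orderOf x ≠ 0 := fun h => hN0 (Nat.eq_zero_of_zero_dvd (h ▸ hdN))
  have hg0 : (orderOf x).gcd m ≠ 0 := Nat.gcd_ne_zero_right hm
  have hmul : orderOf (x ^ m) * (orderOf x).gcd m = orderOf x := by
    rw [orderOf_pow' x hm, Nat.div_mul_cancel (Nat.gcd_dvd_left _ _)]
  have hr0 : orderOf (x ^ m) ≠ 0 := fun h => hd0 (by rw [← hmul, h, zero_mul])
  have hr1 : 1 ≤ padicValNat 2 (orderOf (x ^ m)) :=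
    one_le_padicValNat_of_dvd hr0 heven.two_dvd
  have hdγ : padicValNat 2 (orderOf x) ≤ γ := by
    by_contra! hlt
    exact hN (((padicValNat_dvd_iff_le hd0).mpr hlt).trans hdN)
  have hadd := congrArg (padicValNat 2) hmul
  rw [padicValNat.mul hr0 hg0] at hadd
  have hmin : padicValNat 2 ((orderOf x).gcd m) =
      min (padicValNat 2 (orderOf x)) (padicValNat 2 m) := by
    simp only [← Nat.factorization_def _ Nat.prime_two, Nat.factorization_gcd hd0 hm]
    rfl
  -- If the minimum were `v₂(orderOf x)`, then `x^m` would have odd order; so it is `v₂(m)`.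
  omega

/-! ### The 2-adic criterion -/

theorem selfConjRecipDegree_ne_zero_iff_padicValNat {F : Type*} [Field F] [Finite F] (p : ℕ)
    [Fact p.Prime] [CharP F p] (e : ℕ) (hF : Nat.card F = (p ^ e) ^ 2) {m : ℕ} (hm : 0 < m)
    {a : F} (ha : a ≠ 0) (hr : orderOf a ∣ p ^ e + 1) {γ : ℕ} (hγ : 2 ^ γ ∣ p ^ e + 1)
    (hγ' : ¬ 2 ^ (γ + 1) ∣ p ^ e + 1) :
    selfConjRecipDegree (p ^ e) m a ≠ 0 ↔
      Odd (orderOf a) ∨ padicValNat 2 m + padicValNat 2 (orderOf a) ≤ γ := by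
  rw [selfConjRecipDegree_ne_zero_iff_exists_root p e hF hm ha]
  have hord : orderOf (algebraMap F (AlgebraicClosure F) a) = orderOf a :=
    orderOf_injective (algebraMap F (AlgebraicClosure F)).toMonoidHom
      (algebraMap F (AlgebraicClosure F)).injective a
  constructor
  · rintro ⟨x, hxm, i, hi, hxi⟩
    rw [or_iff_not_imp_left, Nat.not_odd_iff_even]
    intro heven
    have hq : Odd (p ^ e) := by
      have := even_iff_two_dvd.mpr (heven.two_dvd.trans hr)
      rwa [Nat.even_add_one, Nat.not_even_iff_odd] at this
    rw [← hord, ← hxm] at heven ⊢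
    exact padicValNat_add_padicValNat_orderOf_pow_le (Nat.succ_ne_zero _) hm.ne' hxi
      (not_two_pow_dvd_pow_add_one hq hγ hγ' hi) heven
  · intro h
    obtain ⟨i, hi, hdvd⟩ := exists_odd_mul_gcd_dvd hm.ne' hr hγ h
    have he : e ≠ 0 := by
      rintro rfl
      have := Finite.one_lt_card (α := F)
      simp [hF] at this
    -- The characteristic does not divide `q^i+1`, so primitive roots of unity of that order exist.
    have : NeZero (((p ^ e) ^ i + 1 : ℕ) : F) := ⟨by
      rw [Nat.cast_add, Nat.cast_pow, Nat.cast_pow, CharP.cast_eq_zero F p, zero_pow he,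
        zero_pow hi.pos.ne']
      simp⟩
    obtain ⟨x, hxm, hx⟩ := exists_pow_eq_and_pow_eq_one (K := AlgebraicClosure F)
      (N := (p ^ e) ^ i + 1) (m := m) (a := algebraMap F _ a) (by rwa [hord])
    exact ⟨x, hxm, i, hi, hx⟩

theorem lemma4 {F : Type*} [Field F] [Finite F] (p : ℕ) [Fact p.Prime] [CharP F p]
    (q e : ℕ) (hq : q = p ^ e) (hF : Nat.card F = q ^ 2)
    (n nbar ν : ℕ) (hn : 0 < n) (hnbar : n = nbar * p ^ ν) (hp : ¬ p ∣ nbar)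
    (lam : F) (hlam : lam ≠ 0) (r : ℕ) (hr : orderOf lam = r) (hrq : r ∣ q + 1)
    (Lam : F) (hLam : Lam ^ (p ^ ν) = lam)
    (γ : ℕ) (hγ : 2 ^ γ ∣ q + 1) (hγ' : ¬ 2 ^ (γ + 1) ∣ q + 1) :
    (Even r →
      (selfConjRecipDegree q nbar Lam ≠ 0 ↔
        padicValNat 2 nbar + padicValNat 2 r ≤ γ ∧ r ∈ setM q)) ∧
    (Odd r → (selfConjRecipDegree q nbar Lam ≠ 0 ↔ r ∈ setM q)) ∧
    (Even r →
      (selfConjRecipDegree q nbar Lam = 0 ↔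
        γ < padicValNat 2 nbar + padicValNat 2 r ∨ r ∉ setM q)) ∧
    (Odd r → (selfConjRecipDegree q nbar Lam = 0 ↔ r ∉ setM q)) := by
  subst hq
  have hm : 0 < nbar := Nat.pos_of_ne_zero fun h => hp (h ▸ dvd_zero p)
  have hLam0 : Lam ≠ 0 := by
    rintro rfl
    exact hlam (by rw [← hLam, zero_pow (pow_ne_zero _ (Fact.out : p.Prime).ne_zero)])
  have hord : orderOf Lam = r := by
    rw [← hr, ← hLam, ← iterateFrobenius_def]
    exact (orderOf_injective (iterateFrobenius F p ν : F →* F) (iterateFrobenius_inj F p ν)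
      Lam).symm
  have hmem : r ∈ setM (p ^ e) :=
    ⟨Nat.pos_of_dvd_of_pos hrq (Nat.succ_pos _), 1, one_pos, odd_one, by rwa [pow_one]⟩
  have key := selfConjRecipDegree_ne_zero_iff_padicValNat p e hF hm hLam0 (hord ▸ hrq) hγ hγ'
  rw [hord] at key
  have hEven : Even r → (selfConjRecipDegree (p ^ e) nbar Lam ≠ 0 ↔
      padicValNat 2 nbar + padicValNat 2 r ≤ γ ∧ r ∈ setM (p ^ e)) := fun h => by
    rw [key, or_iff_right (Nat.not_odd_iff_even.mpr h), and_iff_left hmem]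
  have hOdd : Odd r → (selfConjRecipDegree (p ^ e) nbar Lam ≠ 0 ↔ r ∈ setM (p ^ e)) :=
    fun h => iff_of_true (key.mpr (.inl h)) hmem
  refine ⟨hEven, hOdd, fun h => ?_, fun h => not_iff_not.mp ?_⟩
  · rw [← not_iff_not, ← Ne, hEven h, not_or, not_lt, not_not]
  · rw [not_not]
    exact hOdd h
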